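/- Let $G$ be a Polish group and let $W\leqslant G$ be an open subgroup of infinite index such that $G=\mathrm{Comm}_G(W)$, where $$\mathrm{Comm}_G(W)=\{g\in G : [W:W\cap gWg^{-1}]<\infty \text{ and } [gWg^{-1}:gWg^{-1}\cap W]<\infty\}$$ is the commensurator of $W$ in $G$. Then $G$ admits a continuous affine representation on a separable Hilbert space for which every orbit is unbounded; that is, there are a separable real Hilbert space $\mathcal H$ and a homomorphism $\rho$ from $G$ to the group of affine automorphisms of $\mathcal H$ such that the action map $G\times\mathcal H\to\mathcal H$, $(g,\xi)\mapsto\rho(g)\xi$, is jointly continuous and, for every $\xi\in\mathcal H$, the orbit $\{\rho(g)\xi : g\in G\}$ is unbounded in norm. -/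

import Mathlib

open MulAction TopologicalSpace Filter Topology
open scoped ENNReal InnerProductSpace Pointwise

/-! On the infinite countable set `X = G ⧸ W` the subgroup `W` has finite orbits. Suppose `r > 0` is
square-summable and `W`-invariant, and each `g` distorts it by a bounded factor. Permuting
coordinates on the `ℓ²` space of weight `r⁻²` is then a bounded representation, isometric on `W`,
hence continuous. Since `r` tends to zero at infinity, every nonzero vector has an unbounded orbit.
In unweighted coordinates the functional `⟪r, ·⟫` is the sum of the coordinates, so it is invariant;
the hyperplane through `r` orthogonal to `r` is preserved and misses `0`, which gives the affine
action.

The weight is `r = √a`, where `a = ∑ 2⁻ⁿ m*ⁿ` for a positive `W`-invariant subprobability `m` on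
`X`. The inequality `m * a ≤ 2a` bounds the distortion (`exists_summable_quasiInvariant`). -/

/-! ### A summable quasi-invariant weight -/

/-- If the point stabilizer `stabilizer G o` has finite orbits on the countable set `X`, then there
is a positive finite measure on `X` that it preserves. -/
theorem exists_pos_stabilizer_invariant_tsum_le_one {G X : Type*} [Group G] [MulAction G X]
    [Countable X] (o : X) (hfin : ∀ x : X, (orbit (stabilizer G o) x).Finite) :
    ∃ m : X → ℝ≥0∞, (∀ x, m x ≠ 0) ∧ ∑' x, m x ≤ 1 ∧
      ∀ g ∈ stabilizer G o, ∀ x, m (g • x) = m x := by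
  obtain ⟨ε, hε, hsum⟩ := ENNReal.exists_pos_sum_of_countable' one_ne_zero X
  refine ⟨fun x => ⨅ y : orbit (stabilizer G o) x, ε y, fun x => ?_, ?_, fun g hg x => ?_⟩
  · have := (hfin x).to_subtype
    have : Nonempty (orbit (stabilizer G o) x) := ⟨⟨x, mem_orbit_self x⟩⟩
    -- Finiteness of the orbit makes the infimum a minimum, hence nonzero.
    obtain ⟨y, hy⟩ := exists_eq_ciInf_of_finite (f := fun y : orbit (stabilizer G o) x => ε y)
    exact hy.symm.trans_ne (hε y).ne'
  · refine le_trans (ENNReal.tsum_le_tsum fun x => ?_) hsum.le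
    exact iInf_le (fun y : orbit (stabilizer G o) x => ε y) ⟨x, mem_orbit_self x⟩
  · have h : orbit (stabilizer G o) (g • x) = orbit (stabilizer G o) x :=
      orbit_eq_iff.2 ⟨⟨g, hg⟩, rfl⟩
    exact congrArg (fun S : Set X => ⨅ y : S, ε y) h

/-- The `n`-step distributions of the left random walk on `X` with step distribution `m`,
where `s z` carries the base point `o` to `z`. -/
noncomputable def walkDistribution {G X : Type*} [Group G] [MulAction G X] [DecidableEq X]
    (o : X) (s : X → G) (m : X → ℝ≥0∞) : ℕ → X → ℝ≥0∞
  | 0 => fun y => if y = o then 1 else 0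
  | n + 1 => fun y => ∑' z, m z * walkDistribution o s m n ((s z)⁻¹ • y)

theorem tsum_walkDistribution_le_one {G X : Type*} [Group G] [MulAction G X] [DecidableEq X]
    (o : X) (s : X → G) (m : X → ℝ≥0∞) (hm : ∑' x, m x ≤ 1) (n : ℕ) :
    ∑' y, walkDistribution o s m n y ≤ 1 := by
  induction n with
  | zero => simp [walkDistribution]
  | succ n ih =>
    simp only [walkDistribution]
    rw [ENNReal.tsum_comm]
    calc ∑' z, ∑' y, m z * walkDistribution o s m n ((s z)⁻¹ • y)
        = ∑' z, m z * ∑' y, walkDistribution o s m n y := by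
          refine tsum_congr fun z => ?_
          rw [ENNReal.tsum_mul_left]
          congr 1
          exact (MulAction.toPerm (s z)⁻¹).tsum_eq (walkDistribution o s m n)
      _ ≤ ∑' z, m z * 1 := by gcongr
      _ ≤ 1 := by simpa using hm

/-- After reindexing by `z ↦ g • z`, the elements `s (g • z)` and `g * s z` both carry `o` to `g •
z`. They differ on the right by a stabilizer element, which the induction hypothesis absorbs. -/
theorem walkDistribution_smul {G X : Type*} [Group G] [MulAction G X] [DecidableEq X]
    (o : X) (s : X → G) (hs : ∀ x, s x • o = x) (m : X → ℝ≥0∞)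
    (hm : ∀ g ∈ stabilizer G o, ∀ x, m (g • x) = m x) (n : ℕ) :
    ∀ g ∈ stabilizer G o, ∀ x, walkDistribution o s m n (g • x) = walkDistribution o s m n x := by
  induction n with
  | zero =>
    intro g hg x
    have : g • x = o ↔ x = o := by
      rw [← smul_left_cancel_iff g (x := x) (y := o), mem_stabilizer_iff.1 hg]
    simp [walkDistribution, this]
  | succ n ih =>
    intro g hg x
    simp only [walkDistribution]
    rw [← (MulAction.toPerm g).tsum_eq]
    refine tsum_congr fun z => ?_
    simp only [MulAction.toPerm_apply]
    rw [hm g hg]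
    congr 1
    have hv : (s (g • z))⁻¹ * g * s z ∈ stabilizer G o := by
      rw [mem_stabilizer_iff, mul_smul, mul_smul, hs, inv_smul_eq_iff, hs]
    rw [← ih _ hv ((s z)⁻¹ • x), smul_smul, smul_smul]
    congr 2
    group

/-- On a countable transitive `G`-set whose point stabilizer has finite orbits there is a positive
summable function, invariant under the point stabilizer, that every group element distorts by a
bounded factor. -/
theorem exists_summable_quasiInvariant {G X : Type*} [Group G] [MulAction G X]
    [IsPretransitive G X] [Countable X] (o : X)
    (hfin : ∀ x : X, (orbit (stabilizer G o) x).Finite) :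
    ∃ a : X → ℝ, (∀ x, 0 < a x) ∧ Summable a ∧ (∀ g : G, ∃ C : ℝ, ∀ x, a (g • x) ≤ C * a x) ∧
      ∀ g ∈ stabilizer G o, ∀ x, a (g • x) = a x := by
  classical
  obtain ⟨m, hm0, hm1, hmW⟩ := exists_pos_stabilizer_invariant_tsum_le_one o hfin
  choose s hs using fun x : X => exists_smul_eq G o x
  set p := walkDistribution o s m with hp
  set A : X → ℝ≥0∞ := fun y => ∑' n, 2⁻¹ ^ n * p n y with hA
  have hAsum : ∑' y, A y ≤ 2 := by
    rw [ENNReal.tsum_comm]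
    calc ∑' n, ∑' y, 2⁻¹ ^ n * p n y ≤ ∑' n : ℕ, (2⁻¹ : ℝ≥0∞) ^ n * 1 := by
          refine ENNReal.tsum_le_tsum fun n => ?_
          rw [ENNReal.tsum_mul_left]
          gcongr
          exact tsum_walkDistribution_le_one o s m hm1 n
      _ = 2 := by simp [ENNReal.tsum_geometric]
  have hAtop : ∑' y, A y ≠ ⊤ := ne_top_of_le_ne_top (by simp) hAsum
  have hAfin : ∀ y, A y ≠ ⊤ := ENNReal.ne_top_of_tsum_ne_top hAtop
  have hmfin : ∀ y, m y ≠ ⊤ := ENNReal.ne_top_of_tsum_ne_top (ne_top_of_le_ne_top (by simp) hm1)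
  have hAW : ∀ g ∈ stabilizer G o, ∀ x, A (g • x) = A x := by
    intro g hg x
    simp only [hA, hp, walkDistribution_smul o s hs m hmW _ g hg]
  -- One more step of the walk shifts the series for `A` by one index, at the cost of a factor 2;
  -- only the `z` term of the convolution is kept.
  have hstep : ∀ z y, m z * A ((s z)⁻¹ • y) ≤ 2 * A y := by
    intro z y
    calc m z * A ((s z)⁻¹ • y) = ∑' n, m z * (2⁻¹ ^ n * p n ((s z)⁻¹ • y)) := by
          rw [ENNReal.tsum_mul_left]
      _ ≤ ∑' n, 2 * (2⁻¹ ^ (n + 1) * p (n + 1) y) := by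
          refine ENNReal.tsum_le_tsum fun n => ?_
          have h2 : (2 : ℝ≥0∞) * 2⁻¹ ^ (n + 1) = 2⁻¹ ^ n := by
            rw [pow_succ', ← mul_assoc, ENNReal.mul_inv_cancel (by simp) (by simp), one_mul]
          rw [← mul_assoc 2, h2, mul_left_comm]
          gcongr
          exact ENNReal.le_tsum (f := fun z => m z * p n ((s z)⁻¹ • y)) z
      _ = 2 * ∑' n, 2⁻¹ ^ (n + 1) * p (n + 1) y := ENNReal.tsum_mul_left
      _ ≤ 2 * A y := by
          gcongr
          exact ENNReal.tsum_comp_le_tsum_of_injective (add_left_injective 1)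
            fun n => 2⁻¹ ^ n * p n y
  have hAo : A o ≠ 0 := by
    have h : (2⁻¹ : ℝ≥0∞) ^ 0 * p 0 o ≤ A o := ENNReal.le_tsum 0
    have h1 : p 0 o = 1 := by simp [hp, walkDistribution]
    rw [h1] at h
    intro h0
    simp [h0] at h
  have hApos : ∀ y, A y ≠ 0 := by
    intro y h0
    have h := hstep y y
    have hy : (s y)⁻¹ • y = o := by rw [inv_smul_eq_iff, hs]
    rw [hy, h0, mul_zero, nonpos_iff_eq_zero, mul_eq_zero] at h
    exact h.elim (hm0 y) hAo
  refine ⟨fun x => (A x).toReal, fun x => ENNReal.toReal_pos (hApos x) (hAfin x),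
    ENNReal.summable_toReal hAtop, fun g => ?_, fun g hg x => by simp only [hAW g hg x]⟩
  -- With this `z`, the elements `g` and `(s z)⁻¹` differ on the left by a stabilizer element, so
  -- `A` cannot distinguish them and `hstep` applies.
  set z := g⁻¹ • o with hz
  refine ⟨2 / (m z).toReal, fun x => ?_⟩
  have hmz : 0 < (m z).toReal := ENNReal.toReal_pos (hm0 z) (hmfin z)
  have hv : g * s z ∈ stabilizer G o := by
    rw [mem_stabilizer_iff, mul_smul, hs, hz, smul_inv_smul]
  have hgx : A (g • x) = A ((s z)⁻¹ • x) := by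
    rw [← hAW _ hv ((s z)⁻¹ • x), smul_smul]
    congr 2
    group
  have h := ENNReal.toReal_mono (by finiteness [hAfin x]) (hstep z x)
  rw [ENNReal.toReal_mul, ENNReal.toReal_mul, ← hgx] at h
  rw [div_mul_eq_mul_div, le_div_iff₀ hmz, mul_comm]
  simpa using h

/-! ### Weighted translations on `ℓ²(X)` -/

theorem summable_sq_of_lp_two {X : Type*} (f : lp (fun _ : X => ℝ) 2) :
    Summable fun x => f x ^ 2 := by
  have h := (lp.memℓp f).summable (by simp)
  simpa using h

theorem lp_two_norm_sq_eq_tsum {X : Type*} (f : lp (fun _ : X => ℝ) 2) :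
    ‖f‖ ^ 2 = ∑' x, f x ^ 2 := by
  have h := lp.norm_rpow_eq_tsum (p := 2) (by simp) f
  simpa using h

/-- A countably supported real `ℓ²` space is separable. -/
theorem separableSpace_lp_two {X : Type*} [Countable X] :
    SeparableSpace (lp (fun _ : X => ℝ) 2) := by
  classical
  rw [← isSeparable_univ_iff]
  have hsep : IsSeparable (Set.range fun x : X => (lp.single 2 x (1 : ℝ) : lp (fun _ : X => ℝ) 2)) :=
    (Set.countable_range _).isSeparable
  refine (hsep.span (R := ℝ)).closure.mono fun f _ => ?_
  refine mem_closure_of_tendsto (lp.hasSum_single (by simp) f) (Eventually.of_forall fun F => ?_)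
  refine Submodule.sum_mem _ fun i _ => ?_
  have : lp.single 2 i (f i) = f i • (lp.single 2 i (1 : ℝ) : lp (fun _ : X => ℝ) 2) := by
    rw [← lp.single_smul]; simp
  rw [this]
  exact Submodule.smul_mem _ _ (Submodule.subset_span ⟨i, rfl⟩)

theorem memℓp_two_ratio_mul_comp {G X : Type*} [Group G] [MulAction G X] {r : X → ℝ}
    (hr : ∀ x, 0 < r x) {g : G} {C : ℝ} (hC : ∀ x, r (g⁻¹ • x) ≤ C * r x)
    (f : lp (fun _ : X => ℝ) 2) :
    (Summable fun x => (r (g⁻¹ • x) / r x * f (g⁻¹ • x)) ^ 2) ∧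
      ∑' x, (r (g⁻¹ • x) / r x * f (g⁻¹ • x)) ^ 2 ≤ C ^ 2 * ‖f‖ ^ 2 := by
  have hb : ∀ x, (r (g⁻¹ • x) / r x * f (g⁻¹ • x)) ^ 2 ≤ C ^ 2 * f (g⁻¹ • x) ^ 2 := by
    intro x
    rw [mul_pow]
    gcongr
    · exact div_nonneg (hr _).le (hr _).le
    · rw [div_le_iff₀ (hr x)]
      exact hC x
  have hs : Summable fun x => C ^ 2 * f (g⁻¹ • x) ^ 2 :=
    (((MulAction.toPerm g⁻¹).summable_iff (f := fun x => f x ^ 2)).2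
      (summable_sq_of_lp_two f)).mul_left _
  have hs' := Summable.of_nonneg_of_le (fun x => sq_nonneg _) hb hs
  refine ⟨hs', (hs'.tsum_le_tsum hb hs).trans_eq ?_⟩
  rw [tsum_mul_left, lp_two_norm_sq_eq_tsum]
  congr 1
  exact (MulAction.toPerm g⁻¹).tsum_eq fun x => f x ^ 2

/-- The operator `f ↦ (r (g⁻¹ • ·) / r) * f (g⁻¹ • ·)` on `ℓ²(X)`. It is conjugate to the
permutation operator of `g` on the `ℓ²` space of weight `r⁻²`. -/
noncomputable def weightedTranslation {G X : Type*} [Group G] [MulAction G X] (r : X → ℝ)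
    (hr : ∀ x, 0 < r x) (hC : ∀ g : G, ∃ C : ℝ, ∀ x, r (g • x) ≤ C * r x) (g : G) :
    lp (fun _ : X => ℝ) 2 →L[ℝ] lp (fun _ : X => ℝ) 2 :=
  LinearMap.mkContinuous
    { toFun := fun f => ⟨fun x => r (g⁻¹ • x) / r x * f (g⁻¹ • x), memℓp_gen (by
        simpa [← abs_div, ← abs_mul] using (memℓp_two_ratio_mul_comp hr (hC g⁻¹).choose_spec f).1)⟩
      map_add' := fun f h => by ext x; exact mul_add _ _ _
      map_smul' := fun c f => by ext x; exact mul_left_comm _ _ _ }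
    |(hC g⁻¹).choose| fun f => by
      refine le_of_sq_le_sq ?_ (by positivity)
      rw [lp_two_norm_sq_eq_tsum, mul_pow, sq_abs]
      exact (memℓp_two_ratio_mul_comp hr (hC g⁻¹).choose_spec f).2

section weightedTranslation

variable {G X : Type*} [Group G] [MulAction G X] {r : X → ℝ} (hr : ∀ x, 0 < r x)
  (hC : ∀ g : G, ∃ C : ℝ, ∀ x, r (g • x) ≤ C * r x)

theorem weightedTranslation_apply (g : G) (f : lp (fun _ : X => ℝ) 2) (x : X) :
    weightedTranslation r hr hC g f x = r (g⁻¹ • x) / r x * f (g⁻¹ • x) := rfl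

theorem weightedTranslation_one (f : lp (fun _ : X => ℝ) 2) :
    weightedTranslation r hr hC (1 : G) f = f := by
  ext x
  simp [weightedTranslation_apply, (hr x).ne']

theorem weightedTranslation_mul (g h : G) (f : lp (fun _ : X => ℝ) 2) :
    weightedTranslation r hr hC (g * h) f =
      weightedTranslation r hr hC g (weightedTranslation r hr hC h f) := by
  ext x
  have h1 := (hr x).ne'
  have h2 := (hr (g⁻¹ • x)).ne'
  simp only [weightedTranslation_apply, mul_inv_rev, mul_smul]
  field_simp

theorem norm_weightedTranslation_le {g : G} (hg : ∀ x, r (g⁻¹ • x) = r x)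
    (f : lp (fun _ : X => ℝ) 2) : ‖weightedTranslation r hr hC g f‖ ≤ ‖f‖ := by
  refine le_of_sq_le_sq ?_ (norm_nonneg f)
  rw [lp_two_norm_sq_eq_tsum]
  refine (memℓp_two_ratio_mul_comp hr (C := 1) (fun x => ?_) f).2.trans_eq (by simp)
  rw [hg, one_mul]

theorem inner_weightedTranslation (w : lp (fun _ : X => ℝ) 2) (hw : ∀ x, w x = r x) (g : G)
    (f : lp (fun _ : X => ℝ) 2) : ⟪w, weightedTranslation r hr hC g f⟫_ℝ = ⟪w, f⟫_ℝ := by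
  rw [lp.inner_eq_tsum, lp.inner_eq_tsum,
    ← (MulAction.toPerm g⁻¹).tsum_eq fun x => ⟪w x, f x⟫_ℝ]
  refine tsum_congr fun x => ?_
  have h1 := (hr x).ne'
  simp only [weightedTranslation_apply, hw, MulAction.toPerm_apply, RCLike.inner_apply, conj_trivial]
  field_simp

theorem weightedTranslation_single [DecidableEq X] {g : G} {x : X} (hg : g • x = x) (c : ℝ) :
    weightedTranslation r hr hC g (lp.single 2 x c) = lp.single 2 x c := by
  ext y
  rw [weightedTranslation_apply]
  have hx : g⁻¹ • x = x := by rw [inv_smul_eq_iff, hg]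
  by_cases h : y = x
  · subst h
    rw [hx, div_self (hr y).ne', one_mul]
  · have h' : g⁻¹ • y ≠ x := by
      rw [Ne, inv_smul_eq_iff, hg]
      exact h
    rw [lp.single_apply_ne _ _ _ h, lp.single_apply_ne _ _ _ h', mul_zero]

/-- If `f x₀ ≠ 0`, the translate by `g` has modulus `r x₀ * |f x₀| / r (g • x₀)` at `g • x₀`. By
transitivity a norm bound would keep `r` away from zero on the infinite set `X`, against
summability. -/
theorem not_bddAbove_norm_weightedTranslation [IsPretransitive G X] [Infinite X]
    (hsum : Summable fun x => r x ^ 2) {f : lp (fun _ : X => ℝ) 2} (hf : f ≠ 0) :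
    ¬ BddAbove (Set.range fun g : G => ‖weightedTranslation r hr hC g f‖) := by
  rintro ⟨B, hB⟩
  obtain ⟨x₀, hx₀⟩ : ∃ x, f x ≠ 0 := by
    by_contra! h
    exact hf (lp.ext (funext h))
  have hc : 0 < r x₀ * |f x₀| := mul_pos (hr x₀) (abs_pos.2 hx₀)
  have hle : ∀ x, r x₀ * |f x₀| ≤ B * r x := by
    intro x
    obtain ⟨g, rfl⟩ := exists_smul_eq G x₀ x
    have h := (lp.norm_apply_le_norm (by simp) (weightedTranslation r hr hC g f) (g • x₀)).trans
      (hB ⟨g, rfl⟩)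
    rw [weightedTranslation_apply, inv_smul_smul, norm_mul, Real.norm_eq_abs, Real.norm_eq_abs,
      abs_of_pos (div_pos (hr _) (hr _)), div_mul_eq_mul_div, div_le_iff₀ (hr _)] at h
    exact h
  have hlim : Tendsto (fun x => B ^ 2 * r x ^ 2) cofinite (𝓝 (B ^ 2 * 0)) :=
    hsum.tendsto_cofinite_zero.const_mul _
  rw [mul_zero] at hlim
  have h := ge_of_tendsto' hlim fun x => by
    rw [← mul_pow]
    exact pow_le_pow_left₀ hc.le (hle x) 2
  exact absurd h (not_le.2 (pow_pos hc 2))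

/-- Near `1` the operators are contractions and fix any given finitely supported vector; such
vectors are dense. The group law carries continuity to every `g₀`. -/
theorem continuous_weightedTranslation [TopologicalSpace G] [IsTopologicalGroup G]
    (hopen : ∀ x : X, IsOpen (stabilizer G x : Set G))
    (hinv : ∀ᶠ g : G in 𝓝 1, ∀ x, r (g⁻¹ • x) = r x) :
    Continuous fun p : G × lp (fun _ : X => ℝ) 2 => weightedTranslation r hr hC p.1 p.2 := by
  classical
  have hone : ∀ f : lp (fun _ : X => ℝ) 2,
      Tendsto (fun p : G × lp (fun _ : X => ℝ) 2 => weightedTranslation r hr hC p.1 p.2)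
        (𝓝 (1, f)) (𝓝 f) := by
    intro f
    rw [Metric.tendsto_nhds]
    intro ε hε
    obtain ⟨F, hF⟩ := ((Metric.tendsto_nhds.1 (lp.hasSum_single (by simp) f)) (ε / 3)
      (by positivity)).exists
    set u : lp (fun _ : X => ℝ) 2 := ∑ i ∈ F, lp.single 2 i (f i) with hu
    have hfix : ∀ᶠ g : G in 𝓝 1, weightedTranslation r hr hC g u = u := by
      have : ∀ᶠ g : G in 𝓝 1, ∀ i ∈ F, g • i = i :=
        (F.eventually_all).2 fun i _ => (hopen i).mem_nhds (one_mem (stabilizer G i))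
      filter_upwards [this] with g hg
      rw [hu, map_sum]
      exact Finset.sum_congr rfl fun i hi => weightedTranslation_single hr hC (hg i hi) _
    rw [nhds_prod_eq]
    filter_upwards [(hinv.and hfix).prod_mk (Metric.ball_mem_nhds f (show 0 < ε / 3 by positivity))]
      with p hp
    obtain ⟨⟨hp1, hp2⟩, hp3⟩ := hp
    have hpf : dist p.2 f < ε / 3 := hp3
    have h1 : ‖weightedTranslation r hr hC p.1 (p.2 - u)‖ ≤ ‖p.2 - u‖ :=
      norm_weightedTranslation_le hr hC hp1 _
    rw [map_sub, hp2, ← dist_eq_norm, ← dist_eq_norm] at h1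
    have h2 := dist_triangle (weightedTranslation r hr hC p.1 p.2) u f
    have h3 := dist_triangle p.2 f u
    rw [dist_comm f u] at h3
    linarith
  rw [continuous_iff_continuousAt]
  rintro ⟨g₀, f⟩
  have hmap : Tendsto (fun p : G × lp (fun _ : X => ℝ) 2 => (g₀⁻¹ * p.1, p.2)) (𝓝 (g₀, f))
      (𝓝 (1, f)) := by
    have : Continuous fun p : G × lp (fun _ : X => ℝ) 2 => (g₀⁻¹ * p.1, p.2) := by fun_prop
    simpa using this.tendsto (g₀, f)
  have h := ((weightedTranslation r hr hC g₀).continuous.tendsto f).comp ((hone f).comp hmap)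
  refine h.congr fun p => ?_
  simp only [Function.comp_apply, ← weightedTranslation_mul, mul_inv_cancel_left]

end weightedTranslation

/-! ### From the invariant functional to the affine action -/

/-- A linear representation that leaves `⟪w, ·⟫` invariant restricts to an affine action on the
hyperplane through `w` orthogonal to `w`, transported here to the subspace `(ℝ ∙ w)ᗮ`. -/
noncomputable def affineActionOfInner {G E : Type*} [Group G] [NormedAddCommGroup E]
    [InnerProductSpace ℝ E] (π : G → E →L[ℝ] E) (hone : ∀ f, π 1 f = f)
    (hmul : ∀ g h f, π (g * h) f = π g (π h f)) (w : E)
    (hw : ∀ g f, ⟪w, π g f⟫_ℝ = ⟪w, f⟫_ℝ) : G →* ((ℝ ∙ w)ᗮ ≃ᵃ[ℝ] (ℝ ∙ w)ᗮ) :=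
  have hmem : ∀ g (v : (ℝ ∙ w)ᗮ), π g v ∈ (ℝ ∙ w)ᗮ := fun g v => by
    rw [Submodule.mem_orthogonal_singleton_iff_inner_right, hw]
    exact Submodule.mem_orthogonal_singleton_iff_inner_right.1 v.2
  have hmem' : ∀ g, π g w - w ∈ (ℝ ∙ w)ᗮ := fun g => by
    rw [Submodule.mem_orthogonal_singleton_iff_inner_right, inner_sub_right, hw, sub_self]
  let lin : G → ((ℝ ∙ w)ᗮ ≃ₗ[ℝ] (ℝ ∙ w)ᗮ) := fun g =>
    { toFun := fun v => ⟨π g v, hmem g v⟩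
      invFun := fun v => ⟨π g⁻¹ v, hmem g⁻¹ v⟩
      map_add' := fun u v => Subtype.ext (by simp)
      map_smul' := fun c v => Subtype.ext (by simp)
      left_inv := fun v => Subtype.ext (by simp [← hmul, hone])
      right_inv := fun v => Subtype.ext (by simp [← hmul, hone]) }
  { toFun := fun g => (lin g).toAffineEquiv.trans
      (AffineEquiv.constVAdd ℝ (ℝ ∙ w)ᗮ ⟨π g w - w, hmem' g⟩)
    map_one' := by
      ext v
      simp [lin, hone]
    map_mul' := fun g h => by
      ext v
      simp only [lin, hmul, AffineEquiv.mul_def, AffineEquiv.trans_apply,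
        AffineEquiv.constVAdd_apply, LinearEquiv.coe_toAffineEquiv, LinearEquiv.coe_mk,
        LinearMap.coe_mk, AddHom.coe_mk, vadd_eq_add, Submodule.coe_add, map_add, map_sub]
      abel }

theorem coe_affineActionOfInner {G E : Type*} [Group G] [NormedAddCommGroup E]
    [InnerProductSpace ℝ E] (π : G → E →L[ℝ] E) (hone : ∀ f, π 1 f = f)
    (hmul : ∀ g h f, π (g * h) f = π g (π h f)) (w : E)
    (hw : ∀ g f, ⟪w, π g f⟫_ℝ = ⟪w, f⟫_ℝ) (g : G) (v : (ℝ ∙ w)ᗮ) :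
    (affineActionOfInner π hone hmul w hw g v : E) = π g (w + v) - w := by
  have : (affineActionOfInner π hone hmul w hw g v : E) = (π g w - w) + π g v := rfl
  rw [this, map_add]
  abel

/-- A group acting transitively on an infinite countable set with open point stabilizers, such that
the point stabilizers have finite orbits, has a continuous affine action on a separable Hilbert
space without bounded orbits. -/
theorem exists_affineAction_unbounded_of_isPretransitive {G : Type*} {X : Type} [Group G]
    [TopologicalSpace G] [IsTopologicalGroup G] [MulAction G X] [IsPretransitive G X]
    [Countable X] [Infinite X] (o : X) (hopen : IsOpen (stabilizer G o : Set G))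
    (hfin : ∀ x : X, (orbit (stabilizer G o) x).Finite) :
    ∃ (H : Type) (_ : NormedAddCommGroup H) (_ : InnerProductSpace ℝ H)
      (_ : CompleteSpace H) (_ : TopologicalSpace.SeparableSpace H)
      (ρ : G →* (H ≃ᵃ[ℝ] H)),
      Continuous (fun p : G × H => ρ p.1 p.2) ∧
      ∀ x : H, ¬ Bornology.IsBounded (Set.range fun g : G => ρ g x) := by
  obtain ⟨a, ha, hasum, haC, haW⟩ := exists_summable_quasiInvariant o hfin
  have hr : ∀ x, 0 < √(a x) := fun x => Real.sqrt_pos.2 (ha x)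
  have hC : ∀ g : G, ∃ C : ℝ, ∀ x, √(a (g • x)) ≤ C * √(a x) := fun g => by
    obtain ⟨C, hC⟩ := haC g
    refine ⟨√C, fun x => ?_⟩
    rw [← Real.sqrt_mul' _ (ha x).le]
    exact Real.sqrt_le_sqrt (hC x)
  have hsum : Summable fun x => √(a x) ^ 2 := by
    simpa only [Real.sq_sqrt (ha _).le] using hasum
  let w : lp (fun _ : X => ℝ) 2 := ⟨fun x => √(a x), memℓp_gen (by simpa using hsum)⟩
  have hw : ∀ x, w x = √(a x) := fun _ => rfl
  have hw0 : w ≠ 0 := fun h => by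
    have := hw o
    rw [h] at this
    exact (hr o).ne this
  have hopen' : ∀ x : X, IsOpen (stabilizer G x : Set G) := fun x => by
    obtain ⟨g, rfl⟩ := exists_smul_eq G o x
    have hc : Continuous fun v : G => g⁻¹ * v * g := by fun_prop
    convert hopen.preimage hc using 1
    ext v
    simp only [SetLike.mem_coe, mem_stabilizer_iff, Set.mem_preimage, mul_smul, inv_smul_eq_iff]
  have hinv : ∀ᶠ g : G in 𝓝 1, ∀ x, √(a (g⁻¹ • x)) = √(a x) := by
    filter_upwards [hopen.mem_nhds (one_mem (stabilizer G o))] with g hg x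
    rw [haW g⁻¹ (inv_mem hg)]
  have hcont := continuous_weightedTranslation hr hC hopen' hinv
  have hinner := inner_weightedTranslation hr hC w hw
  have : SeparableSpace (lp (fun _ : X => ℝ) 2) := separableSpace_lp_two
  have : SecondCountableTopology (lp (fun _ : X => ℝ) 2) :=
    UniformSpace.secondCountable_of_separable _
  refine ⟨(ℝ ∙ w)ᗮ, inferInstance, inferInstance, inferInstance, inferInstance,
    affineActionOfInner (weightedTranslation _ hr hC) (weightedTranslation_one hr hC)
      (weightedTranslation_mul hr hC) w hinner, ?_, fun v hbdd => ?_⟩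
  · rw [continuous_induced_rng]
    simp only [Function.comp_def, coe_affineActionOfInner]
    have : Continuous fun p : G × (ℝ ∙ w)ᗮ => (p.1, w + (p.2 : lp (fun _ : X => ℝ) 2)) := by
      fun_prop
    exact (hcont.comp this).sub continuous_const
  -- Pairing with `w` gives `‖w‖ ^ 2`, so the hyperplane misses the origin.
  · have hne : w + (v : lp (fun _ : X => ℝ) 2) ≠ 0 := fun h => by
      have h0 : ⟪w, w + (v : lp (fun _ : X => ℝ) 2)⟫_ℝ = 0 := by rw [h, inner_zero_right]
      rw [inner_add_right, Submodule.mem_orthogonal_singleton_iff_inner_right.1 v.2, add_zero,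
        inner_self_eq_zero] at h0
      exact hw0 h0
    obtain ⟨B, hB⟩ := hbdd.exists_norm_le
    refine not_bddAbove_norm_weightedTranslation hr hC hsum hne ⟨B + ‖w‖, ?_⟩
    rintro _ ⟨g, rfl⟩
    have h := hB _ ⟨g, rfl⟩
    rw [Submodule.coe_norm, coe_affineActionOfInner] at h
    have h' := norm_add_le (weightedTranslation (fun x => √(a x)) hr hC g (w + v) - w) w
    rw [sub_add_cancel] at h'
    exact h'.trans (by gcongr)

/-! ### Cosets of a commensurated open subgroup -/

/-- A subgroup commensurated by the whole group has finite orbits on its cosets. -/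
theorem finite_orbit_quotient_of_commensurator_eq_top {G : Type*} [Group G] (W : Subgroup G)
    (hW : Subgroup.Commensurable.commensurator W = ⊤) (x : G ⧸ W) : (orbit W x).Finite := by
  obtain ⟨g, rfl⟩ := QuotientGroup.mk_surjective x
  have hg : g ∈ Subgroup.Commensurable.commensurator W := hW ▸ Subgroup.mem_top g
  rw [Subgroup.Commensurable.commensurator_mem_iff] at hg
  have hstab : stabilizer W (g : G ⧸ W) = (ConjAct.toConjAct g • W).subgroupOf W := by
    ext v
    rw [mem_stabilizer_iff, Subgroup.mem_subgroupOf, Subgroup.mem_pointwise_smul_iff_inv_smul_mem,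
      ← map_inv, ConjAct.toConjAct_smul, inv_inv, ← inv_mem_iff]
    change ((v * g : G) : G ⧸ W) = g ↔ _
    rw [QuotientGroup.eq]
    simp [mul_assoc]
  -- An infinite index and the `ncard` of an infinite set are both `0`, so nonvanishing expresses
  -- finiteness.
  have hidx : (orbit W (g : G ⧸ W)).ncard ≠ 0 := by
    rw [← index_stabilizer, hstab]
    exact hg.1
  exact Set.finite_of_ncard_ne_zero hidx

theorem mainTheorem7 {G : Type*} [Group G] [TopologicalSpace G] [IsTopologicalGroup G]
    [PolishSpace G] (W : Subgroup G) (hW_open : IsOpen (W : Set G))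
    (hW_index : ¬ W.FiniteIndex)
    (hW_comm : Subgroup.Commensurable.commensurator W = ⊤) :
    ∃ (H : Type) (_ : NormedAddCommGroup H) (_ : InnerProductSpace ℝ H)
      (_ : CompleteSpace H) (_ : TopologicalSpace.SeparableSpace H)
      (ρ : G →* (H ≃ᵃ[ℝ] H)),
      Continuous (fun p : G × H => ρ p.1 p.2) ∧
      ∀ x : H, ¬ Bornology.IsBounded (Set.range fun g : G => ρ g x) := by
  have : DiscreteTopology (G ⧸ W) := QuotientGroup.discreteTopology hW_open
  -- The quotient of a separable group is separable, and here it is discrete.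
  have : Countable (G ⧸ W) := separableSpace_iff_countable.1 inferInstance
  have : Infinite (G ⧸ W) := not_finite_iff_infinite.1 fun _ =>
    hW_index Subgroup.finiteIndex_of_finite_quotient
  -- The coset space is countable, so a copy in `Type` exists, as the universe of `H` requires.
  let e : G ⧸ W ≃ Shrink.{0} (G ⧸ W) := equivShrink.{0} (G ⧸ W)
  have he : ∀ (g : G) (x : G ⧸ W), g • e x = e (g • x) := fun g x =>
    (equivShrink_smul.{0} g x).symm
  have : Countable (Shrink.{0} (G ⧸ W)) := e.symm.injective.countable
  have : Infinite (Shrink.{0} (G ⧸ W)) := Infinite.of_injective e e.injective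
  have : IsPretransitive G (Shrink.{0} (G ⧸ W)) := ⟨fun x y => by
    obtain ⟨x, rfl⟩ := e.surjective x
    obtain ⟨y, rfl⟩ := e.surjective y
    obtain ⟨g, hg⟩ := exists_smul_eq G x y
    exact ⟨g, by rw [he, hg]⟩⟩
  have hstab : stabilizer G (e ((1 : G) : G ⧸ W)) = W := by
    ext g
    rw [mem_stabilizer_iff, he, e.apply_eq_iff_eq, ← mem_stabilizer_iff, stabilizer_quotient]
  refine exists_affineAction_unbounded_of_isPretransitive (e ((1 : G) : G ⧸ W))
    (by rwa [hstab]) fun x => ?_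
  obtain ⟨x, rfl⟩ := e.surjective x
  rw [hstab]
  refine ((finite_orbit_quotient_of_commensurator_eq_top W hW_comm x).image e).subset ?_
  rintro _ ⟨g, rfl⟩
  exact ⟨g • x, ⟨g, rfl⟩, (he g x).symm⟩
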